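/- A flow of a monoid $M$ on an object $X$ of a category $\mathcal C$ is a monoid morphism $M\to\mathcal C(X,X)$; morphisms of flows are the equivariant morphisms of $\mathcal C$. For a constraint $\mathcal F$ let ${}_{\mathcal F}\mathcal C^{M}$ be the full subcategory of flows in $\mathcal C$ whose action map $M\times X\to X$, $(s,x)\mapsto s\triangleright x$, satisfies $\mathcal F$. A category is cocomplete if it has all small colimits. For a family member $S\subseteq M$, separate (uniform) continuity over $S\times X$ means (uniform) continuity of $(s,x)\mapsto s\triangleright x$ in each variable when the other is kept fixed; subsets of $M$ carry the subspace structure and products the product structure. **Theorem.** Let $M$ be a monoid and let $\mathcal S,\mathcal J\subseteq 2^{M}$ be families of subsets of $M$. The category ${}_{\mathcal F}\mathcal C^{M}$ is cocomplete in each of the following cases. (a) $M$ is a topological monoid; $\mathcal C$ is the category of all topological spaces, or of $T_0$, $T_1$, Hausdorff, functionally Hausdorff (distinct points are told apart by a continuous real-valued function), Tychonoff, or compact Hausdorff spaces, with continuous maps; $\mathcal F$ requires the action to be separately continuous over $S\times X$ for every $S\in\mathcal S$ and jointly continuous over $J\times X$ for every $J\in\mathcal J$. (b) $M$ is equipped with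 a uniformity; $\mathcal C$ is the category of all uniform spaces, or of Hausdorff, or of complete Hausdorff uniform spaces, with uniformly continuous maps; $\mathcal F$ requires the action to be separately uniformly continuous over $S\times X$ for every $S\in\mathcal S$ and jointly uniformly continuous over $J\times X$ for every $J\in\mathcal J$. (c) Call a space compactly generated if a subset is open whenever its intersection with every compact subspace $K$ is open in $K$; let $\kappa$ be the coreflection of topological spaces onto compactly generated ones, and $A\times^{\kappa}B=\kappa(A\times B)$. $M$ is a compactly generated space whose multiplication $M\times^{\kappa}M\to M$ is continuous; $\mathcal C$ is the category of all compactly generated spaces or of Hausdorff compactly generated spaces; $\mathcal F$ requires the action to be separately continuous over $\kappa(S)\times X$ for every $S\in\mathcal S$ and jointly continuous on $\kappa(J)\times^{\kappa}X$ for every $J\in\mathcal J$. (d) $M$ is a topological group; $\mathcal C$ is one of the three categories of uniform spaces in (b); $\mathcal F$ requires either that the action be bounded (for every entourage $V$ of $X$ there is a neighbourhood $N$ of $1\in M$ with $(s\triangleright x,x)\in V$ for all $s\in N$, $x\in X$), or that it be quasi-bounded (for every entourage $W$ of $X$ there are a neighbourhood $N$ of $1\in M$ and an entourage $V$ of $X$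 with $(s\triangleright x,s\triangleright y)\in W$ for all $s\in N$, $(x,y)\in V$). -/

import Mathlib

open CategoryTheory CategoryTheory.Limits
open scoped Uniformity Topology CompactCoherentification

universe u

namespace FlowCat

/-! ### Categories of spaces -/

/-- Functionally Hausdorff spaces: any two distinct points are told apart by some continuous
real-valued function. -/
def FunctionallyHausdorff (X : Type u) [TopologicalSpace X] : Prop :=
  ∀ x y : X, x ≠ y → ∃ f : X → ℝ, Continuous f ∧ f x ≠ f y

/-- Labels for the categories of topological spaces under consideration. -/
inductive TopKind
  | all
  | t0
  | t1
  | t2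
  | functionallyT2
  | tychonoff
  | compactT2

/-- The spaces belonging to the category with a given label. -/
def TopKind.prop : TopKind → ObjectProperty TopCat.{u}
  | .all => fun _ => True
  | .t0 => fun X => T0Space X
  | .t1 => fun X => T1Space X
  | .t2 => fun X => T2Space X
  | .functionallyT2 => fun X => FunctionallyHausdorff X
  | .tychonoff => fun X => T35Space X
  | .compactT2 => fun X => CompactSpace X ∧ T2Space X

/-- Labels for the categories of uniform spaces under consideration. -/
inductive UnifKind
  | all
  | t2
  | completeT2

/-- The uniform spaces belonging to the category with a given label. -/
def UnifKind.prop : UnifKind → ObjectProperty UniformSpaceCat.{u}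
  | .all => fun _ => True
  | .t2 => fun X => T2Space X
  | .completeT2 => fun X => CompleteSpace X ∧ T2Space X

/-- Labels for the categories of compactly generated spaces under consideration. -/
inductive KappaKind
  | all
  | t2

/-- The compactly generated spaces (a set is open as soon as its trace on every compact subspace
`K` is open in `K`) belonging to the category with a given label. -/
def KappaKind.prop : KappaKind → ObjectProperty TopCat.{u}
  | .all => fun X => CompactlyCoherentSpace X
  | .t2 => fun X => CompactlyCoherentSpace X ∧ T2Space X

/-! ### Flows

A flow of a monoid `M` on an object `X` of a category is a monoid morphism from `M` to the
endomorphisms of `X`, and a morphism of flows is an equivariant morphism of the category: this is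
Mathlib's `Action`. -/

section Flows

variable {M : Type u} [Monoid M]

/-- The underlying action map `M → X → X` of a flow in a full subcategory of `TopCat`. -/
def topAct {P : ObjectProperty TopCat.{u}} (A : Action P.FullSubcategory M) (m : M) :
    A.V.obj → A.V.obj :=
  ConcreteCategory.hom (C := TopCat.{u}) (InducedCategory.Hom.hom (A.ρ m))

/-- The underlying action map `M → X → X` of a flow in a full subcategory of
`UniformSpaceCat`. -/
def unifAct {P : ObjectProperty UniformSpaceCat.{u}} (A : Action P.FullSubcategory M) (m : M) :
    A.V.obj → A.V.obj :=
  ConcreteCategory.hom (C := UniformSpaceCat.{u}) (InducedCategory.Hom.hom (A.ρ m))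

end Flows

/-! ### Constraints on action maps -/

section Constraints

variable {M X : Type u}

/-- `S × X → X` is continuous in each variable when the other one is kept fixed. -/
def SeparatelyContinuousOver [TopologicalSpace M] [TopologicalSpace X]
    (act : M → X → X) (S : Set M) : Prop :=
  (∀ s ∈ S, Continuous (act s)) ∧ ∀ x : X, Continuous fun s : S => act s x

/-- `J × X → X` is continuous for the product topology. -/
def JointlyContinuousOver [TopologicalSpace M] [TopologicalSpace X]
    (act : M → X → X) (J : Set M) : Prop :=
  Continuous fun p : J × X => act p.1 p.2

/-- `S × X → X` is uniformly continuous in each variable when the other one is kept fixed. -/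
def SeparatelyUniformContinuousOver [UniformSpace M] [UniformSpace X]
    (act : M → X → X) (S : Set M) : Prop :=
  (∀ s ∈ S, UniformContinuous (act s)) ∧ ∀ x : X, UniformContinuous fun s : S => act s x

/-- `J × X → X` is uniformly continuous for the product uniformity. -/
def JointlyUniformContinuousOver [UniformSpace M] [UniformSpace X]
    (act : M → X → X) (J : Set M) : Prop :=
  UniformContinuous fun p : J × X => act p.1 p.2

/-- `κ(S) × X → X` is continuous in each variable when the other one is kept fixed. Here `𝐤` is the
coreflection onto compactly generated spaces, applied to the subspace `S` of `M`. -/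
def KappaSeparatelyContinuousOver [TopologicalSpace M] [TopologicalSpace X]
    (act : M → X → X) (S : Set M) : Prop :=
  (∀ s ∈ S, Continuous (act s)) ∧
    ∀ x : X, Continuous fun s : 𝐤 S => act ((CompactCoherentification.mk S).symm s) x

/-- `κ(J) ×^κ X → X` is continuous, where `A ×^κ B = κ(A × B)` is the product of compactly generated
spaces. -/
def KappaJointlyContinuousOver [TopologicalSpace M] [TopologicalSpace X]
    (act : M → X → X) (J : Set M) : Prop :=
  Continuous fun q : 𝐤 (𝐤 J × X) =>
    act ((CompactCoherentification.mk J).symm ((CompactCoherentification.mk (𝐤 J × X)).symm q).1)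
      ((CompactCoherentification.mk (𝐤 J × X)).symm q).2

/-- Boundedness of an action on a uniform space: for every entourage `V` there is a neighbourhood
`N` of the identity with `(s ▹ x, x) ∈ V` for all `s ∈ N` and all `x`. -/
def Bounded [Monoid M] [TopologicalSpace M] [UniformSpace X] (act : M → X → X) : Prop :=
  ∀ V ∈ 𝓤 X, ∃ N ∈ 𝓝 (1 : M), ∀ s ∈ N, ∀ x : X, (act s x, x) ∈ V

/-- Quasi-boundedness of an action on a uniform space: for every entourage `W` there are a
neighbourhood `N` of the identity and an entourage `V` with `(s ▹ x, s ▹ y) ∈ W` for all `s ∈ N` and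
`(x, y) ∈ V`. -/
def QuasiBounded [Monoid M] [TopologicalSpace M] [UniformSpace X] (act : M → X → X) : Prop :=
  ∀ W ∈ 𝓤 X, ∃ N ∈ 𝓝 (1 : M), ∃ V ∈ 𝓤 X, ∀ s ∈ N, ∀ p ∈ V, (act s p.1, act s p.2) ∈ W

/-- Monoid objects in the category of compactly generated spaces with the product `×^κ`:
the multiplication `M ×^κ M → M` is continuous. -/
def IsKappaMonoid (M : Type u) [Monoid M] [TopologicalSpace M] : Prop :=
  CompactlyCoherentSpace M ∧
    Continuous fun q : 𝐤 (M × M) =>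
      ((CompactCoherentification.mk (M × M)).symm q).1 *
        ((CompactCoherentification.mk (M × M)).symm q).2

end Constraints

/-! ### Flow categories: full subcategories of the category of all flows in the base category -/

/-- Flows in a category of topological spaces that are separately continuous over `S × X` for `S ∈ 𝒮`
and jointly continuous over `J × X` for `J ∈ 𝒥`. -/
abbrev TopFlow (k : TopKind) (M : Type u) [Monoid M] [TopologicalSpace M] (𝒮 𝒥 : Set (Set M)) :
    Type (u + 1) :=
  ObjectProperty.FullSubcategory fun A : Action (TopKind.prop.{u} k).FullSubcategory M =>
    (∀ S ∈ 𝒮, SeparatelyContinuousOver (topAct A) S) ∧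
      ∀ J ∈ 𝒥, JointlyContinuousOver (topAct A) J

/-- Flows in a category of uniform spaces that are separately uniformly continuous over `S × X` for
`S ∈ 𝒮` and jointly uniformly continuous over `J × X` for `J ∈ 𝒥`. -/
abbrev UnifFlow (k : UnifKind) (M : Type u) [Monoid M] [UniformSpace M] (𝒮 𝒥 : Set (Set M)) :
    Type (u + 1) :=
  ObjectProperty.FullSubcategory fun A : Action (UnifKind.prop.{u} k).FullSubcategory M =>
    (∀ S ∈ 𝒮, SeparatelyUniformContinuousOver (unifAct A) S) ∧
      ∀ J ∈ 𝒥, JointlyUniformContinuousOver (unifAct A) J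

/-- Flows in a category of compactly generated spaces that are separately continuous over `κ(S) × X`
for `S ∈ 𝒮` and jointly continuous over `κ(J) ×^κ X` for `J ∈ 𝒥`. -/
abbrev KappaFlow (k : KappaKind) (M : Type u) [Monoid M] [TopologicalSpace M]
    (𝒮 𝒥 : Set (Set M)) : Type (u + 1) :=
  ObjectProperty.FullSubcategory fun A : Action (KappaKind.prop.{u} k).FullSubcategory M =>
    (∀ S ∈ 𝒮, KappaSeparatelyContinuousOver (topAct A) S) ∧
      ∀ J ∈ 𝒥, KappaJointlyContinuousOver (topAct A) J

/-- Bounded flows in a category of uniform spaces. -/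
abbrev BoundedFlow (k : UnifKind) (G : Type u) [Group G] [TopologicalSpace G] : Type (u + 1) :=
  ObjectProperty.FullSubcategory fun A : Action (UnifKind.prop.{u} k).FullSubcategory G =>
    Bounded (unifAct A)

/-- Quasi-bounded flows in a category of uniform spaces. -/
abbrev QuasiBoundedFlow (k : UnifKind) (G : Type u) [Group G] [TopologicalSpace G] :
    Type (u + 1) :=
  ObjectProperty.FullSubcategory fun A : Action (UnifKind.prop.{u} k).FullSubcategory G =>
    QuasiBounded (unifAct A)

end FlowCat

/-!
Each of the flow categories is cocomplete because it is complete and cocones over a small diagram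
are, up to refinement, bounded in size: this is the general adjoint functor theorem applied to the
diagonal functor `E ⥤ (J ⥤ E)`, whose left adjoint computes colimits.

Both ingredients come from one closure property. An invariant subset `S` of a product of flows (a
closed one for compact Hausdorff and for complete Hausdorff spaces) is again a flow of the same
kind, initial for its coordinate projections: continuity of a map into `S`, and each of the
constraints on the action, can be tested on coordinates (`InitialLift`). For compactly generated
spaces the product topology on `S` has to be replaced by its coreflection. Taking for `S` the set of
compatible families gives limits (`hasLimits_of_initialLifts`). Taking for `S ⊆ X` the union of the
images of the legs of a cocone with vertex `X`, which is invariant since the legs are equivariant,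
gives a flow through which the cocone factors. When closedness is needed one takes the closure of
this union; in a Hausdorff space the closure of the image of a set `Q` embeds into `Set (Set Q)`
(`nonempty_closure_range_embedding`), so that its size is still bounded by the diagram. Flows of
bounded size have a small set of representatives (`exists_small_representatives`), and the
solution set condition follows.

`hasColimits_of_initialLifts` carries out this argument for concrete categories;
`hasColimits_topFlow` and `hasColimits_unifFlow` specialize it to flows of spaces and of uniform
spaces with an arbitrary constraint on the action.
-/

namespace FlowCat

/-! ### Cocompleteness of concrete categories with initial lifts -/

section Abstract

universe v

variable {E : Type v} [Category.{u} E] {FE : E → E → Type*} {CE : E → Type u}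
  [∀ X Y, FunLike (FE X Y) (CE X) (CE Y)] [ConcreteCategory.{u} E FE]

/-- An initial lift of a subset `S` of the product of the underlying sets of the objects `X i`:
an object carried by `S` up to a bijection, whose coordinate projections are morphisms, and such
that every family of morphisms `Z ⟶ X i` with values in `S` comes from a morphism into it. -/
structure InitialLift {ι : Type u} (X : ι → E) (S : Set (∀ i, CE (X i))) where
  /-- the object carried by `S` -/
  obj : E
  /-- the bijection of its underlying set with `S` -/
  equiv : CE obj ≃ S
  /-- the coordinate projections -/
  proj (i : ι) : obj ⟶ X i
  proj_apply (i : ι) (y : CE obj) : proj i y = (equiv y).1 i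
  /-- the morphism induced by a family of morphisms with values in `S` -/
  lift {Z : E} (h : ∀ i, Z ⟶ X i) (hS : ∀ z : CE Z, (fun i => h i z) ∈ S) : Z ⟶ obj
  lift_apply {Z : E} (h : ∀ i, Z ⟶ X i) (hS : ∀ z : CE Z, (fun i => h i z) ∈ S) (z : CE Z) :
    (equiv (lift h hS z)).1 = fun i => h i z

namespace InitialLift

variable {ι : Type u} {X : ι → E} {S : Set (∀ i, CE (X i))} (L : InitialLift X S)

lemma lift_proj {Z : E} (h : ∀ i, Z ⟶ X i) (hS : ∀ z : CE Z, (fun i => h i z) ∈ S) (i : ι) :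
    L.lift h hS ≫ L.proj i = h i :=
  ConcreteCategory.ext_apply fun z => by
    rw [ConcreteCategory.comp_apply, L.proj_apply, L.lift_apply]

lemma hom_ext {Z : E} {f g : Z ⟶ L.obj} (h : ∀ i, f ≫ L.proj i = g ≫ L.proj i) : f = g :=
  ConcreteCategory.ext_apply fun z => L.equiv.injective <| Subtype.ext <| funext fun i => by
    rw [← L.proj_apply, ← L.proj_apply, ← ConcreteCategory.comp_apply, h,
      ConcreteCategory.comp_apply]

end InitialLift

/-- The compatible families of points of the objects of a diagram. -/
def compatibleFamilies {J : Type u} [SmallCategory J] (F : J ⥤ E) :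
    Set (∀ j, CE (F.obj j)) :=
  {x | ∀ (i j : J) (f : i ⟶ j), F.map f (x i) = x j}

lemma hasLimits_of_initialLifts
    (H : ∀ (J : Type u) [SmallCategory J] (F : J ⥤ E),
      Nonempty (InitialLift F.obj (compatibleFamilies F))) :
    HasLimits E where
  has_limits_of_shape J _ := ⟨fun F => by
    obtain ⟨L⟩ := H J F
    refine ⟨⟨⟨⟨L.obj, L.proj, ?_⟩, ?_⟩⟩⟩
    · intro i j f
      refine ConcreteCategory.ext_apply fun y => ?_
      have := (L.equiv y).2 i j f
      simp only [Functor.const_obj_obj, Functor.const_obj_map, Category.id_comp,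
        ConcreteCategory.comp_apply]
      rw [L.proj_apply, L.proj_apply, this]
    · have hS (s : Cone F) (z : CE s.pt) :
          (fun i => s.π.app i z) ∈ compatibleFamilies F := fun i j f => by
        rw [← ConcreteCategory.comp_apply, s.w f]
      exact
        { lift := fun s => L.lift (fun j => s.π.app j) (hS s)
          fac := fun s j => L.lift_proj _ _ j
          uniq := fun s m hm => L.hom_ext fun j => (hm j).trans (L.lift_proj _ (hS s) j).symm }⟩

/-- If every object is determined up to isomorphism by a structure transported to a copy of its
underlying set, then the objects whose underlying sets embed into a fixed small set `B` have, up to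
isomorphism, a small set of representatives. -/
lemma exists_small_representatives (T : Type u → Type u)
    (str : ∀ (X : E) (Y : Type u), CE X ≃ Y → T Y)
    (hstr : ∀ (X X' : E) (Y : Type u) (e : CE X ≃ Y) (e' : CE X' ≃ Y), str X Y e = str X' Y e' →
      ∃ f : X ⟶ X', ∀ x, e' (f x) = e x) (B : Type u) :
    ∃ (ι : Type u) (R : ι → E), ∀ X : E, Nonempty (CE X ↪ B) → ∃ i, Nonempty (X ≅ R i) := by
  -- A representative is chosen for each structure, on a subset of `B`, that comes from an object.
  let ι := {p : Σ s : Set B, T s // ∃ (X : E) (e : CE X ≃ p.1), str X p.1 e = p.2}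
  refine ⟨ι, fun p => p.2.choose, fun X ⟨b⟩ => ?_⟩
  let e : CE X ≃ Set.range b := Equiv.ofInjective b b.injective
  let i : ι := ⟨⟨Set.range b, str X _ e⟩, X, e, rfl⟩
  obtain ⟨e', he'⟩ := i.2.choose_spec
  obtain ⟨f, hf⟩ := hstr _ _ _ e e' he'.symm
  obtain ⟨g, hg⟩ := hstr _ _ _ e' e he'
  refine ⟨i, ⟨⟨f, g, ?_, ?_⟩⟩⟩
  · refine ConcreteCategory.ext_apply fun x => e.injective ?_
    rw [ConcreteCategory.comp_apply, hg, hf, ConcreteCategory.id_apply]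
  · refine ConcreteCategory.ext_apply fun x => e'.injective ?_
    rw [ConcreteCategory.comp_apply, hf, hg, ConcreteCategory.id_apply]

/-- In a Hausdorff space, the closure of a small set is small: a point of the closure of the range
of `q : Q → X` is determined by the trace on `Q` of its neighbourhood filter. -/
lemma nonempty_closure_range_embedding {Q X : Type u} [TopologicalSpace X] [T2Space X]
    (q : Q → X) : Nonempty (closure (Set.range q) ↪ Set (Set Q)) := by
  refine ⟨⟨fun x => (Filter.comap q (𝓝 x.1)).sets, fun x y hxy => ?_⟩⟩
  have h : Filter.comap q (𝓝 x.1) = Filter.comap q (𝓝 y.1) := Filter.filter_eq hxy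
  by_contra hne
  have hd : Disjoint (𝓝 x.1) (𝓝 y.1) := disjoint_nhds_nhds.2 fun h' => hne (Subtype.ext h')
  have hd' := Filter.disjoint_comap (m := q) hd
  -- Distinct points with the same trace would force the trace to be trivial, off the closure.
  rw [← h, disjoint_self] at hd'
  obtain ⟨z, hz, hz'⟩ :=
    mem_closure_iff_nhds.1 x.2 _ (Filter.comap_eq_bot_iff_compl_range.1 hd')
  exact hz hz'

lemma nonempty_range_embedding {Q X : Type u} (q : Q → X) :
    Nonempty (Set.range q ↪ Set (Set Q)) :=
  ⟨((Function.Embedding.ofSurjective _ Set.rangeFactorization_surjective).trans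
    ⟨fun x => {x}, Set.singleton_injective⟩).trans ⟨fun x => {x}, Set.singleton_injective⟩⟩

/-- The general adjoint functor theorem, applied to the diagonal functor `E ⥤ (J ⥤ E)`. The
hypothesis `hgen` bounds the size of a lift through which a given family of morphisms factors. -/
lemma hasColimits_of_bounded_initialLifts
    (hlim : ∀ (J : Type u) [SmallCategory J] (F : J ⥤ E),
      Nonempty (InitialLift F.obj (compatibleFamilies F)))
    (hgen : ∀ (X : E) (κ : Type u) (Z : κ → E) (f : ∀ k, Z k ⟶ X),
      ∃ S : Set (PUnit.{u + 1} → CE X), (∀ k z, (fun _ => f k z) ∈ S) ∧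
        Nonempty (S ↪ Set (Set (Σ k, CE (Z k)))) ∧ Nonempty (InitialLift (fun _ => X) S))
    (T : Type u → Type u) (str : ∀ (X : E) (Y : Type u), CE X ≃ Y → T Y)
    (hstr : ∀ (X X' : E) (Y : Type u) (e : CE X ≃ Y) (e' : CE X' ≃ Y), str X Y e = str X' Y e' →
      ∃ f : X ⟶ X', ∀ x, e' (f x) = e x) :
    HasColimits E where
  has_colimits_of_shape J _ := by
    have := hasLimits_of_initialLifts hlim
    rw [hasColimitsOfShape_iff_isRightAdjoint_const]
    refine isRightAdjoint_of_preservesLimits_of_solutionSetCondition _ fun D => ?_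
    obtain ⟨ι, R, hR⟩ := exists_small_representatives T str hstr
      (Set (Set (Σ j, CE (D.obj j))))
    refine ⟨Σ i, D ⟶ (Functor.const J).obj (R i), fun p => R p.1, fun p => p.2, fun X h => ?_⟩
    obtain ⟨S, hS, ⟨b⟩, ⟨L⟩⟩ := hgen X J D.obj fun j => h.app j
    obtain ⟨i, ⟨e⟩⟩ := hR L.obj ⟨L.equiv.toEmbedding.trans b⟩
    let c : D ⟶ (Functor.const J).obj L.obj :=
      { app := fun j => L.lift (fun _ => h.app j) (hS j)
        naturality := fun j j' f => L.hom_ext fun k => by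
          have := h.naturality f
          simp only [Functor.const_obj_obj, Functor.const_obj_map, Category.assoc,
            Category.comp_id] at this ⊢
          rw [L.lift_proj, L.lift_proj, this] }
    refine ⟨⟨i, c ≫ (Functor.const J).map e.hom⟩, e.inv ≫ L.proj ⟨⟩, ?_⟩
    ext j
    simp [c, L.lift_proj]

/-- Cocompleteness criterion for concrete categories whose objects carry a topology and continuous
operations `act X m`, preserved by morphisms. Every subset of a product that is invariant under the
operations must lift; in the case `c`, only the closed ones, provided the spaces are Hausdorff. -/
theorem hasColimits_of_initialLifts [∀ X : E, TopologicalSpace (CE X)]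
    (hcont : ∀ (X Y : E) (f : X ⟶ Y), Continuous f)
    {M : Type u} (act : ∀ X : E, M → CE X → CE X)
    (act_cont : ∀ (X : E) (m : M), Continuous (act X m))
    (map_act : ∀ (X Y : E) (f : X ⟶ Y) (m : M) (x : CE X), f (act X m x) = act Y m (f x))
    (c : Prop) (hc : c → ∀ X : E, T2Space (CE X))
    (H : ∀ (ι : Type u) (X : ι → E) (S : Set (∀ i, CE (X i))),
      (∀ x ∈ S, ∀ m, (fun i => act (X i) m (x i)) ∈ S) → (c → IsClosed S) →
      Nonempty (InitialLift X S))
    (T : Type u → Type u) (str : ∀ (X : E) (Y : Type u), CE X ≃ Y → T Y)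
    (hstr : ∀ (X X' : E) (Y : Type u) (e : CE X ≃ Y) (e' : CE X' ≃ Y), str X Y e = str X' Y e' →
      ∃ f : X ⟶ X', ∀ x, e' (f x) = e x) :
    HasColimits E := by
  refine hasColimits_of_bounded_initialLifts (fun J _ F => H _ _ _ ?_ fun hc' => ?_)
    (fun X κ Z f => ?_) T str hstr
  · intro x hx m i j f
    rw [map_act, hx]
  · have := hc hc'
    simp only [compatibleFamilies, Set.ofPred_forall]
    exact isClosed_iInter fun i => isClosed_iInter fun j => isClosed_iInter fun f =>
      isClosed_eq ((hcont _ _ _).comp (continuous_apply i)) (continuous_apply j)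
  · let q : (Σ k, CE (Z k)) → PUnit.{u + 1} → CE X := fun p _ => f p.1 p.2
    have hq : ∀ m, ∀ x ∈ Set.range q, (fun i => act X m (x i)) ∈ Set.range q := by
      rintro m _ ⟨p, rfl⟩
      exact ⟨⟨p.1, act _ m p.2⟩, funext fun _ => map_act _ _ _ _ _⟩
    by_cases hc' : c
    · have := hc hc'
      refine ⟨closure (Set.range q), fun k z => subset_closure ⟨⟨k, z⟩, rfl⟩,
        nonempty_closure_range_embedding q, H _ _ _ (fun x hx m => ?_) fun _ => isClosed_closure⟩
      have hm : Continuous fun (x : PUnit.{u + 1} → CE X) i => act X m (x i) :=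
        continuous_pi fun i => (act_cont X m).comp (continuous_apply i)
      exact map_mem_closure hm hx (hq m)
    · exact ⟨Set.range q, fun k z => ⟨⟨k, z⟩, rfl⟩, nonempty_range_embedding q,
        H _ _ _ (fun x hx m => hq m x hx) fun h => absurd h hc'⟩

end Abstract

/-! ### Coordinatewise actions -/

section Invariant

variable {M ι : Type u} {X : ι → Type u}

/-- The coordinatewise action on an invariant subset of a product. -/
def piAct (act : ∀ i, M → X i → X i) {S : Set (∀ i, X i)}
    (hS : ∀ x ∈ S, ∀ m, (fun i => act i m (x i)) ∈ S) (m : M) (x : S) : S :=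
  ⟨fun i => act i m (x.1 i), hS x.1 x.2 m⟩

end Invariant

/-! ### Flows in categories of topological spaces -/

section Top

variable {M : Type u} [Monoid M] {P : ObjectProperty TopCat.{u}}

lemma topAct_one (A : Action P.FullSubcategory M) (x : A.V.obj) : topAct A 1 x = x := by
  simp only [topAct, map_one]
  rfl

lemma topAct_mul (A : Action P.FullSubcategory M) (m n : M) (x : A.V.obj) :
    topAct A (m * n) x = topAct A m (topAct A n x) := by
  simp only [topAct, map_mul]
  rfl

lemma continuous_topAct (A : Action P.FullSubcategory M) (m : M) : Continuous (topAct A m) :=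
  (ConcreteCategory.hom (C := TopCat.{u}) (InducedCategory.Hom.hom (A.ρ m))).continuous

/-- The flow on a topological space given by an action by continuous maps. -/
def topActionOf (X : Type u) [TopologicalSpace X] (hP : P (TopCat.of X)) (act : M → X → X)
    (one : ∀ x, act 1 x = x) (mul : ∀ m n x, act (m * n) x = act m (act n x))
    (cont : ∀ m, Continuous (act m)) : Action P.FullSubcategory M where
  V := ⟨TopCat.of X, hP⟩
  ρ :=
    { toFun := fun m => ObjectProperty.homMk (TopCat.ofHom ⟨act m, cont m⟩)
      map_one' := ObjectProperty.hom_ext _ (TopCat.hom_ext (ContinuousMap.ext one))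
      map_mul' := fun m n => ObjectProperty.hom_ext _ (TopCat.hom_ext (ContinuousMap.ext (mul m n))) }

/-- The morphism of flows given by a continuous equivariant map. -/
def topHomOf {A B : Action P.FullSubcategory M} (f : A.V.obj → B.V.obj) (hf : Continuous f)
    (hact : ∀ m x, f (topAct A m x) = topAct B m (f x)) : A ⟶ B where
  hom := ObjectProperty.homMk (TopCat.ofHom ⟨f, hf⟩)
  comm m := ObjectProperty.hom_ext _ (TopCat.hom_ext (ContinuousMap.ext (hact m)))

lemma topHom_comm {A B : Action P.FullSubcategory M} (f : A ⟶ B) (m : M) (x : A.V.obj) :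
    f.hom.hom (topAct A m x) = topAct B m (f.hom.hom x) :=
  ConcreteCategory.congr_hom (C := TopCat.{u}) (congrArg InducedCategory.Hom.hom (f.comm m)) x

/-- The flows in the category of spaces satisfying `P` whose action satisfies `Ψ` form a cocomplete
category if each invariant subset of a product of such flows (closed, in the case `c`) carries
a topology in `P` that is initial for the coordinates among spaces in `P`, and if the coordinatewise
action then satisfies `Ψ`. -/
theorem hasColimits_topFlow (Ψ : ∀ (X : Type u) [TopologicalSpace X], (M → X → X) → Prop)
    (c : Prop) (hc : c → ∀ X : TopCat.{u}, P X → T2Space X)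
    (H : ∀ (ι : Type u) (X : ι → Type u) [∀ i, TopologicalSpace (X i)]
      (act : ∀ i, M → X i → X i), (∀ i, P (TopCat.of (X i))) → (∀ i m, Continuous (act i m)) →
      (∀ i, Ψ (X i) (act i)) → ∀ (S : Set (∀ i, X i))
      (hS : ∀ x ∈ S, ∀ m, (fun i => act i m (x i)) ∈ S), (c → IsClosed S) →
      ∃ _ : TopologicalSpace S, P (TopCat.of S) ∧ (∀ i, Continuous fun x : S => x.1 i) ∧
        (∀ (Z : Type u) [TopologicalSpace Z], P (TopCat.of Z) → ∀ g : Z → S,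
          (∀ i, Continuous fun z => (g z).1 i) → Continuous g) ∧
        Ψ S (piAct act hS)) :
    HasColimits (ObjectProperty.FullSubcategory
      fun A : Action P.FullSubcategory M => Ψ A.V.obj (topAct A)) := by
  let E := ObjectProperty.FullSubcategory
    fun A : Action P.FullSubcategory M => Ψ A.V.obj (topAct A)
  let _ (X : E) : TopologicalSpace (ToType X) :=
    inferInstanceAs (TopologicalSpace X.obj.V.obj)
  refine hasColimits_of_initialLifts (E := E)
    (fun X Y f => (ConcreteCategory.hom (C := TopCat.{u}) f.hom.hom.hom).continuous)
    (fun X => topAct X.obj) (fun X => continuous_topAct X.obj)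
    (fun X Y f => topHom_comm f.hom) c (fun h X => hc h _ X.obj.V.property) ?_
    (fun Y => TopologicalSpace Y × (M → Y → Y))
    (fun X Y e => (.induced e.symm X.obj.V.obj.str, fun m y => e (topAct X.obj m (e.symm y)))) ?_
  · intro ι X S hS hcS
    obtain ⟨t, hP, hproj, hlift, hΨ⟩ := H ι (fun i => (X i).obj.V.obj) (fun i => topAct (X i).obj)
      (fun i => (X i).obj.V.property) (fun i => continuous_topAct _) (fun i => (X i).property)
      S hS hcS
    have hact : ∀ m, Continuous (piAct (fun i => topAct (X i).obj) hS m) := fun m =>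
      hlift S hP _ fun i => (continuous_topAct (X i).obj m).comp (hproj i)
    let Y : E := ⟨topActionOf S hP (piAct (fun i => topAct (X i).obj) hS)
      (fun x => Subtype.ext <| funext fun i => topAct_one _ _)
      (fun m n x => Subtype.ext <| funext fun i => topAct_mul _ _ _ _) hact, hΨ⟩
    exact ⟨{
      obj := Y
      equiv := Equiv.refl _
      proj := fun i => ObjectProperty.homMk (topHomOf (A := Y.obj) (fun x : S => x.1 i) (hproj i)
        fun _ _ => rfl)
      proj_apply := fun i y => rfl
      lift := fun {Z} h hZ => ObjectProperty.homMk (topHomOf (B := Y.obj)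
        (fun z => (⟨fun i => h i z, hZ z⟩ : S))
        (hlift _ Z.obj.V.property _ fun i =>
          (ConcreteCategory.hom (C := TopCat.{u}) (h i).hom.hom.hom).continuous)
        fun m z => Subtype.ext <| funext fun i => topHom_comm (h i).hom m z)
      lift_apply := fun h hS z => rfl }⟩
  · intro X X' Y e e' h
    obtain ⟨h1, h2⟩ := Prod.ext_iff.1 h
    refine ⟨ObjectProperty.homMk (topHomOf (fun x => e'.symm (e x)) ?_ fun m x => ?_),
      fun x => e'.apply_symm_apply (e x)⟩
    · rw [continuous_iff_le_induced]
      have h3 := congrArg (TopologicalSpace.induced e) h1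
      simp only [induced_compose] at h3
      rw [show e.symm ∘ e = id from e.symm_comp_self, induced_id] at h3
      exact h3.le
    · have h3 := congrFun (congrFun h2 m) (e x)
      apply e'.injective
      simp only [Equiv.symm_apply_apply, Equiv.apply_symm_apply] at h3 ⊢
      exact h3

end Top

/-! ### Flows in categories of uniform spaces -/

section Unif

variable {M : Type u} [Monoid M] {P : ObjectProperty UniformSpaceCat.{u}}

lemma unifAct_one (A : Action P.FullSubcategory M) (x : A.V.obj) : unifAct A 1 x = x := by
  simp only [unifAct, map_one]
  rfl

lemma unifAct_mul (A : Action P.FullSubcategory M) (m n : M) (x : A.V.obj) :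
    unifAct A (m * n) x = unifAct A m (unifAct A n x) := by
  simp only [unifAct, map_mul]
  rfl

lemma uniformContinuous_unifAct (A : Action P.FullSubcategory M) (m : M) :
    UniformContinuous (unifAct A m) :=
  (ConcreteCategory.hom (C := UniformSpaceCat.{u}) (InducedCategory.Hom.hom (A.ρ m))).2

/-- The flow on a uniform space given by an action by uniformly continuous maps. -/
def unifActionOf (X : Type u) [UniformSpace X] (hP : P (UniformSpaceCat.of X)) (act : M → X → X)
    (one : ∀ x, act 1 x = x) (mul : ∀ m n x, act (m * n) x = act m (act n x))
    (cont : ∀ m, UniformContinuous (act m)) : Action P.FullSubcategory M where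
  V := ⟨UniformSpaceCat.of X, hP⟩
  ρ :=
    { toFun := fun m => ObjectProperty.homMk (UniformSpaceCat.ofHom ⟨act m, cont m⟩)
      map_one' := ObjectProperty.hom_ext _ (UniformSpaceCat.hom_ext (funext one))
      map_mul' := fun m n => ObjectProperty.hom_ext _ (UniformSpaceCat.hom_ext (funext (mul m n))) }

/-- The morphism of flows given by a uniformly continuous equivariant map. -/
def unifHomOf {A B : Action P.FullSubcategory M} (f : A.V.obj → B.V.obj) (hf : UniformContinuous f)
    (hact : ∀ m x, f (unifAct A m x) = unifAct B m (f x)) : A ⟶ B where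
  hom := ObjectProperty.homMk (UniformSpaceCat.ofHom ⟨f, hf⟩)
  comm m := ObjectProperty.hom_ext _ (UniformSpaceCat.hom_ext (funext (hact m)))

lemma unifHom_comm {A B : Action P.FullSubcategory M} (f : A ⟶ B) (m : M) (x : A.V.obj) :
    f.hom.hom (unifAct A m x) = unifAct B m (f.hom.hom x) :=
  ConcreteCategory.congr_hom (C := UniformSpaceCat.{u})
    (congrArg InducedCategory.Hom.hom (f.comm m)) x

/-- The flows in the category of uniform spaces satisfying `P` whose action satisfies `Ψ` form
a cocomplete category if `P` and `Ψ` are inherited by the invariant subsets (closed, in the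
case `c`) of products. -/
theorem hasColimits_unifFlow (Ψ : ∀ (X : Type u) [UniformSpace X], (M → X → X) → Prop)
    (c : Prop) (hc : c → ∀ X : UniformSpaceCat.{u}, P X → T2Space X)
    (hP : ∀ (ι : Type u) (X : ι → Type u) [∀ i, UniformSpace (X i)],
      (∀ i, P (UniformSpaceCat.of (X i))) → ∀ S : Set (∀ i, X i), (c → IsClosed S) →
      P (UniformSpaceCat.of S))
    (hΨ : ∀ (ι : Type u) (X : ι → Type u) [∀ i, UniformSpace (X i)] (act : ∀ i, M → X i → X i),
      (∀ i m, UniformContinuous (act i m)) → (∀ i, Ψ (X i) (act i)) → ∀ (S : Set (∀ i, X i))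
      (hS : ∀ x ∈ S, ∀ m, (fun i => act i m (x i)) ∈ S), Ψ S (piAct act hS)) :
    HasColimits (ObjectProperty.FullSubcategory
      fun A : Action P.FullSubcategory M => Ψ A.V.obj (unifAct A)) := by
  let E := ObjectProperty.FullSubcategory
    fun A : Action P.FullSubcategory M => Ψ A.V.obj (unifAct A)
  let _ (X : E) : TopologicalSpace (ToType X) :=
    inferInstanceAs (TopologicalSpace X.obj.V.obj)
  refine hasColimits_of_initialLifts (E := E)
    (fun X Y f => (ConcreteCategory.hom (C := UniformSpaceCat.{u}) f.hom.hom.hom).2.continuous)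
    (fun X => unifAct X.obj) (fun X m => (uniformContinuous_unifAct X.obj m).continuous)
    (fun X Y f => unifHom_comm f.hom) c (fun h X => hc h _ X.obj.V.property) ?_
    (fun Y => UniformSpace Y × (M → Y → Y))
    (fun X Y e => (.comap e.symm X.obj.V.obj.str, fun m y => e (unifAct X.obj m (e.symm y)))) ?_
  · intro ι X S hS hcS
    have hproj (i : ι) : UniformContinuous fun x : S => (x.1 i : (X i).obj.V.obj) :=
      (Pi.uniformContinuous_proj _ i).comp uniformContinuous_subtype_val
    have hlift (Z : Type u) [UniformSpace Z] (g : Z → S)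
        (hg : ∀ i, UniformContinuous fun z => ((g z).1 i : (X i).obj.V.obj)) :
        UniformContinuous g :=
      (uniformContinuous_pi.2 hg).subtype_mk _
    let Y : E := ⟨unifActionOf S
      (hP ι (fun i => (X i).obj.V.obj) (fun i => (X i).obj.V.property) S hcS)
      (piAct (fun i => unifAct (X i).obj) hS)
      (fun x => Subtype.ext <| funext fun i => unifAct_one _ _)
      (fun m n x => Subtype.ext <| funext fun i => unifAct_mul _ _ _ _)
      (fun m => hlift S _ fun i => (uniformContinuous_unifAct (X i).obj m).comp (hproj i)),
      hΨ ι (fun i => (X i).obj.V.obj) _ (fun i => uniformContinuous_unifAct _)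
        (fun i => (X i).property) S hS⟩
    exact ⟨{
      obj := Y
      equiv := Equiv.refl _
      proj := fun i => ObjectProperty.homMk (unifHomOf (A := Y.obj) (fun x : S => x.1 i) (hproj i)
        fun _ _ => rfl)
      proj_apply := fun i y => rfl
      lift := fun {Z} h hZ => ObjectProperty.homMk (unifHomOf (B := Y.obj)
        (fun z => (⟨fun i => h i z, hZ z⟩ : S))
        (hlift _ _ fun i =>
          (ConcreteCategory.hom (C := UniformSpaceCat.{u}) (h i).hom.hom.hom).2)
        fun m z => Subtype.ext <| funext fun i => unifHom_comm (h i).hom m z)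
      lift_apply := fun h hS z => rfl }⟩
  · intro X X' Y e e' h
    obtain ⟨h1, h2⟩ := Prod.ext_iff.1 h
    refine ⟨ObjectProperty.homMk (unifHomOf (fun x => e'.symm (e x)) ?_ fun m x => ?_),
      fun x => e'.apply_symm_apply (e x)⟩
    · rw [uniformContinuous_iff_le_comap]
      have h3 := congrArg (UniformSpace.comap e) h1
      simp only [← UniformSpace.comap_comap] at h3
      rw [show e.symm ∘ e = id from e.symm_comp_self, uniformSpace_comap_id] at h3
      exact h3.le
    · have h3 := congrFun (congrFun h2 m) (e x)
      apply e'.injective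
      simp only [Equiv.symm_apply_apply, Equiv.apply_symm_apply] at h3 ⊢
      exact h3

end Unif

/-! ### Separately and jointly continuous flows -/

lemma TopKind.prop_subset_pi (k : TopKind) {ι : Type u} (X : ι → Type u)
    [∀ i, TopologicalSpace (X i)] (hX : ∀ i, k.prop (TopCat.of (X i))) (S : Set (∀ i, X i))
    (hS : k = .compactT2 → IsClosed S) : k.prop (TopCat.of S) := by
  cases k with
  | all => trivial
  | t0 =>
    have (i : ι) : T0Space (X i) := hX i
    exact inferInstanceAs (T0Space S)
  | t1 =>
    have (i : ι) : T1Space (X i) := hX i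
    exact inferInstanceAs (T1Space S)
  | t2 =>
    have (i : ι) : T2Space (X i) := hX i
    exact inferInstanceAs (T2Space S)
  | functionallyT2 =>
    intro x y hxy
    obtain ⟨i, hi⟩ := Function.ne_iff.1 fun h => hxy (Subtype.ext h)
    obtain ⟨f, hf, hne⟩ := hX i _ _ hi
    exact ⟨fun z : S => f (z.1 i),
      hf.comp ((continuous_apply i).comp continuous_subtype_val), hne⟩
  | tychonoff =>
    have (i : ι) : T35Space (X i) := hX i
    exact inferInstanceAs (T35Space S)
  | compactT2 =>
    have (i : ι) : CompactSpace (X i) := (hX i).1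
    have (i : ι) : T2Space (X i) := (hX i).2
    exact ⟨isCompact_iff_compactSpace.1 (hS rfl).isCompact, inferInstanceAs (T2Space S)⟩

theorem hasColimits_TopFlow (k : TopKind) (M : Type u) [Monoid M] [TopologicalSpace M]
    (𝒮 𝒥 : Set (Set M)) : HasColimits (TopFlow k M 𝒮 𝒥) := by
  refine hasColimits_topFlow (P := k.prop)
    (fun X _ act => (∀ S ∈ 𝒮, SeparatelyContinuousOver act S) ∧
      ∀ J ∈ 𝒥, JointlyContinuousOver act J) (k = .compactT2)
    (fun h X hX => by subst h; exact hX.2) fun ι X _ act hP hact hΨ S hS hcS => ?_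
  have hlift (Z : Type u) [TopologicalSpace Z] (g : Z → S)
      (hg : ∀ i, Continuous fun z => (g z).1 i) : Continuous g :=
    (continuous_pi hg).subtype_mk _
  have hproj (i : ι) : Continuous fun x : S => x.1 i :=
    (continuous_apply i).comp continuous_subtype_val
  refine ⟨inferInstance, k.prop_subset_pi X hP S hcS, hproj, fun Z _ _ g hg => hlift Z g hg,
    fun T hT => ⟨fun s _ => ?_, fun x => ?_⟩, fun J hJ => ?_⟩
  · exact hlift _ _ fun i => (hact i s).comp (hproj i)
  · exact hlift _ _ fun i => ((hΨ i).1 T hT).2 (x.1 i)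
  · exact hlift _ _ fun i => ((hΨ i).2 J hJ).comp
      (continuous_fst.prodMk ((hproj i).comp continuous_snd))

/-! ### Flows of compactly generated spaces -/

section Kappa

open CompactCoherentification

/-- A map into `𝐤 Y` from a compactly generated space is continuous as soon as it is
continuous as a map into `Y`. -/
lemma continuous_mk_comp {Z Y : Type u} [TopologicalSpace Z] [CompactlyCoherentSpace Z]
    [TopologicalSpace Y] {g : Z → Y} (hg : Continuous g) :
    Continuous (CompactCoherentification.mk Y ∘ g) := by
  rw [← CompactCoherentification.map_comp_mk]
  exact (continuous_map_of_continuous hg).comp continuous_mk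

lemma compactlyCoherentSpace_of_homeomorph {X Y : Type u} [TopologicalSpace X] [TopologicalSpace Y]
    [CompactlyCoherentSpace Y] (e : X ≃ₜ Y) : CompactlyCoherentSpace X := by
  refine .of_isOpen_forall_compactSpace fun s hs => ?_
  rw [← e.symm.isOpen_preimage, CompactlyCoherentSpace.isOpen_iff_forall_compactSpace]
  exact fun K _ _ f hf => hs K _ (e.symm.continuous.comp hf)

/-- The coreflection `𝐤 Y`, as a topology on `Y` itself. -/
lemma exists_compactlyCoherent_refinement (Y : Type u) [tY : TopologicalSpace Y] :
    ∃ t : TopologicalSpace Y, @CompactlyCoherentSpace Y t ∧ t ≤ tY ∧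
      ∀ (Z : Type u) [TopologicalSpace Z] [CompactlyCoherentSpace Z] (g : Z → Y),
        Continuous[_, tY] g → Continuous[_, t] g := by
  -- The topology of `𝐤 Y` is fixed first: it must not refer to the new topology on `Y`.
  obtain ⟨tk, hk, hmk, hg⟩ : ∃ _ : TopologicalSpace (𝐤 Y), CompactlyCoherentSpace (𝐤 Y) ∧
      Continuous (CompactCoherentification.mk Y).symm ∧
      ∀ (Z : Type u) [TopologicalSpace Z] [CompactlyCoherentSpace Z] (g : Z → Y),
        Continuous g → Continuous (CompactCoherentification.mk Y ∘ g) :=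
    ⟨instTopologicalSpace, inferInstance, continuous_mk_symm, fun _ _ _ _ h => continuous_mk_comp h⟩
  refine ⟨.induced (CompactCoherentification.mk Y) tk, ?_, ?_, fun Z _ _ g h =>
    continuous_induced_rng.2 (hg Z g h)⟩
  · let _ : TopologicalSpace Y := .induced (CompactCoherentification.mk Y) tk
    exact compactlyCoherentSpace_of_homeomorph
      ((CompactCoherentification.mk Y).toHomeomorphOfIsInducing ⟨rfl⟩)
  · refine (induced_mono (continuous_iff_le_induced.1 hmk)).trans_eq ?_
    rw [induced_compose, Equiv.symm_comp_self, induced_id]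

theorem hasColimits_KappaFlow (k : KappaKind) (M : Type u) [Monoid M] [TopologicalSpace M]
    (𝒮 𝒥 : Set (Set M)) : HasColimits (KappaFlow k M 𝒮 𝒥) := by
  refine hasColimits_topFlow (P := k.prop)
    (fun X _ act => (∀ S ∈ 𝒮, KappaSeparatelyContinuousOver act S) ∧
      ∀ J ∈ 𝒥, KappaJointlyContinuousOver act J) False
    (fun h => h.elim) fun ι X _ act hP hact hΨ S hS _ => ?_
  have hgen (Z : TopCat.{u}) (hZ : k.prop Z) : CompactlyCoherentSpace Z := by
    cases k with
    | all => exact hZ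
    | t2 => exact hZ.1
  have hT2 (h : k = .t2) : T2Space S := by
    subst h
    have (i : ι) : T2Space (X i) := (hP i).2
    infer_instance
  have hproj₀ (i : ι) : Continuous fun x : S => x.1 i :=
    (continuous_apply i).comp continuous_subtype_val
  have hlift₀ (Z : Type u) [TopologicalSpace Z] (g : Z → S)
      (hg : ∀ i, Continuous fun z => (g z).1 i) : Continuous g :=
    (continuous_pi hg).subtype_mk _
  obtain ⟨t, ht, hle, hlift₁⟩ := exists_compactlyCoherent_refinement S
  have hlift (Z : Type u) [TopologicalSpace Z] [CompactlyCoherentSpace Z] (g : Z → S)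
      (hg : ∀ i, Continuous fun z => (g z).1 i) : Continuous[_, t] g :=
    hlift₁ Z g (hlift₀ Z g hg)
  have hproj (i : ι) : Continuous[t, _] fun x : S => x.1 i :=
    continuous_le_dom hle (hproj₀ i)
  refine ⟨t, ?_, hproj, fun Z _ hZ g hg => ?_, fun T hT => ⟨fun s _ => ?_, fun x => ?_⟩,
    fun J hJ => ?_⟩
  · cases k with
    | all => exact ht
    | t2 => exact ⟨ht, t2Space_antitone hle (hT2 rfl)⟩
  · have := hgen _ hZ
    exact hlift Z g hg
  · exact hlift _ _ fun i => (hact i s).comp (hproj i)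
  · exact hlift _ _ fun i => ((hΨ i).1 T hT).2 (x.1 i)
  · refine hlift _ _ fun i => ?_
    have hm : Continuous fun p : 𝐤 J × S => (p.1, p.2.1 i) :=
      continuous_fst.prodMk ((hproj i).comp continuous_snd)
    have := ((hΨ i).2 J hJ).comp (continuous_mk_comp (hm.comp continuous_mk_symm))
    simpa only [Function.comp_def, Equiv.symm_apply_apply, piAct] using this

end Kappa

/-! ### Flows of uniform spaces -/

section Unif

lemma UnifKind.prop_subset_pi (k : UnifKind) (ι : Type u) (X : ι → Type u)
    [∀ i, UniformSpace (X i)] (hX : ∀ i, k.prop (UniformSpaceCat.of (X i))) (S : Set (∀ i, X i))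
    (hS : k = .completeT2 → IsClosed S) : k.prop (UniformSpaceCat.of S) := by
  cases k with
  | all => trivial
  | t2 =>
    have (i : ι) : T2Space (X i) := hX i
    exact inferInstanceAs (T2Space S)
  | completeT2 =>
    have (i : ι) : CompleteSpace (X i) := (hX i).1
    have (i : ι) : T2Space (X i) := (hX i).2
    exact ⟨(hS rfl).completeSpace_coe, inferInstanceAs (T2Space S)⟩

lemma UnifKind.t2Space_of_completeT2 {k : UnifKind} (h : k = .completeT2) (X : UniformSpaceCat.{u})
    (hX : k.prop X) : T2Space X := by
  subst h
  exact hX.2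

theorem hasColimits_UnifFlow (k : UnifKind) (M : Type u) [Monoid M] [UniformSpace M]
    (𝒮 𝒥 : Set (Set M)) : HasColimits (UnifFlow k M 𝒮 𝒥) := by
  refine hasColimits_unifFlow (P := k.prop)
    (fun X _ act => (∀ S ∈ 𝒮, SeparatelyUniformContinuousOver act S) ∧
      ∀ J ∈ 𝒥, JointlyUniformContinuousOver act J) (k = .completeT2)
    UnifKind.t2Space_of_completeT2 k.prop_subset_pi fun ι X _ act hact hΨ S hS => ?_
  have hlift (Z : Type u) [UniformSpace Z] (g : Z → S)
      (hg : ∀ i, UniformContinuous fun z => (g z).1 i) : UniformContinuous g :=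
    (uniformContinuous_pi.2 hg).subtype_mk _
  have hproj (i : ι) : UniformContinuous fun x : S => x.1 i :=
    (Pi.uniformContinuous_proj _ i).comp uniformContinuous_subtype_val
  refine ⟨fun T hT => ⟨fun s _ => ?_, fun x => ?_⟩, fun J hJ => ?_⟩
  · exact hlift _ _ fun i => (hact i s).comp (hproj i)
  · exact hlift _ _ fun i => ((hΨ i).1 T hT).2 (x.1 i)
  · exact hlift _ _ fun i => ((hΨ i).2 J hJ).comp
      (uniformContinuous_fst.prodMk ((hproj i).comp uniformContinuous_snd))

lemma tendsto_uniformity_subset_pi {α ι : Type u} {X : ι → Type u} [∀ i, UniformSpace (X i)]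
    {S : Set (∀ i, X i)} {l : Filter α} {f : α → S × S}
    (hf : ∀ i, Filter.Tendsto (fun a => ((f a).1.1 i, (f a).2.1 i)) l (𝓤 (X i))) :
    Filter.Tendsto f l (𝓤 S) := by
  rw [uniformity_subtype, Filter.tendsto_comap_iff, Pi.uniformity, Filter.tendsto_iInf]
  exact fun i => Filter.tendsto_comap_iff.2 (hf i)

variable {M X : Type u} [Monoid M] [TopologicalSpace M] [UniformSpace X]

lemma bounded_iff_tendsto (act : M → X → X) : Bounded act ↔
    Filter.Tendsto (fun q : M × X => (act q.1 q.2, q.2)) (𝓝 1 ×ˢ ⊤) (𝓤 X) := by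
  refine forall₂_congr fun V _ => ?_
  rw [Filter.mem_map, Filter.mem_prod_top]
  exact (Filter.exists_mem_subset_iff (s := {s | ∀ x, (act s x, x) ∈ V}))

lemma quasiBounded_iff_tendsto (act : M → X → X) : QuasiBounded act ↔
    Filter.Tendsto (fun q : M × X × X => (act q.1 q.2.1, act q.1 q.2.2)) (𝓝 1 ×ˢ 𝓤 X) (𝓤 X) := by
  refine forall₂_congr fun W _ => ?_
  rw [Filter.mem_map, Filter.mem_prod_iff]
  refine exists_congr fun N => and_congr_right fun _ => exists_congr fun V =>
    and_congr_right fun _ => ?_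
  exact ⟨fun h q hq => h q.1 hq.1 q.2 hq.2, fun h s hs p hp => h (Set.mk_mem_prod hs hp)⟩

theorem hasColimits_BoundedFlow (k : UnifKind) (G : Type u) [Group G] [TopologicalSpace G] :
    HasColimits (BoundedFlow k G) := by
  refine hasColimits_unifFlow (P := k.prop) (fun X _ act => Bounded act) (k = .completeT2)
    UnifKind.t2Space_of_completeT2 k.prop_subset_pi fun ι X _ act hact hΨ S hS => ?_
  rw [bounded_iff_tendsto]
  refine tendsto_uniformity_subset_pi fun i => ?_
  exact ((bounded_iff_tendsto _).1 (hΨ i)).comp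
    (Filter.tendsto_fst.prodMk (Filter.tendsto_top (f := fun q : G × S => q.2.1 i)))

theorem hasColimits_QuasiBoundedFlow (k : UnifKind) (G : Type u) [Group G] [TopologicalSpace G] :
    HasColimits (QuasiBoundedFlow k G) := by
  refine hasColimits_unifFlow (P := k.prop) (fun X _ act => QuasiBounded act) (k = .completeT2)
    UnifKind.t2Space_of_completeT2 k.prop_subset_pi fun ι X _ act hact hΨ S hS => ?_
  rw [quasiBounded_iff_tendsto]
  refine tendsto_uniformity_subset_pi fun i => ?_
  have hproj : UniformContinuous fun x : S => x.1 i :=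
    (Pi.uniformContinuous_proj _ i).comp uniformContinuous_subtype_val
  exact ((quasiBounded_iff_tendsto _).1 (hΨ i)).comp
    (Filter.tendsto_fst.prodMk (Filter.Tendsto.comp hproj Filter.tendsto_snd))

end Unif

end FlowCat

theorem theorem2p8 :
    (∀ (k : FlowCat.TopKind) (M : Type u) [Monoid M] [TopologicalSpace M] [ContinuousMul M]
        (𝒮 𝒥 : Set (Set M)), HasColimits (FlowCat.TopFlow k M 𝒮 𝒥)) ∧
    (∀ (k : FlowCat.UnifKind) (M : Type u) [Monoid M] [UniformSpace M]
        (𝒮 𝒥 : Set (Set M)), HasColimits (FlowCat.UnifFlow k M 𝒮 𝒥)) ∧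
    (∀ (k : FlowCat.KappaKind) (M : Type u) [Monoid M] [TopologicalSpace M]
        (_ : FlowCat.IsKappaMonoid M)
        (𝒮 𝒥 : Set (Set M)), HasColimits (FlowCat.KappaFlow k M 𝒮 𝒥)) ∧
    (∀ (k : FlowCat.UnifKind) (G : Type u) [Group G] [TopologicalSpace G] [IsTopologicalGroup G],
        HasColimits (FlowCat.BoundedFlow k G) ∧ HasColimits (FlowCat.QuasiBoundedFlow k G)) :=
  ⟨fun k M _ _ _ 𝒮 𝒥 => FlowCat.hasColimits_TopFlow k M 𝒮 𝒥,
    fun k M _ _ 𝒮 𝒥 => FlowCat.hasColimits_UnifFlow k M 𝒮 𝒥,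
    fun k M _ _ _ 𝒮 𝒥 => FlowCat.hasColimits_KappaFlow k M 𝒮 𝒥,
    fun k G _ _ _ => ⟨FlowCat.hasColimits_BoundedFlow k G, FlowCat.hasColimits_QuasiBoundedFlow k G⟩⟩
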